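/- Let $d \ge 0$ and $m \ge 3$ be integers and let $H_{1,2}, H_{2,3}, \ldots, H_{m-1,m}, H_{m,1} \in \mathrm{O}(d)$ be real orthogonal $d\times d$ matrices. Let $P = H_{1,2} H_{2,3} \cdots H_{m,1}$ and suppose that $-1$ is not an eigenvalue of $P$. View real $md \times md$ matrices as $m\times m$ arrays of $d\times d$ blocks, and let $C$ be the symmetric matrix with blocks $C_{i,i+1} = -H_{i,i+1}$ and $C_{i+1,i} = -H_{i,i+1}^\top$ for $i = 1,\ldots,m$ (indices modulo $m$, so that $H_{m,m+1} = H_{m,1}$), all other blocks being zero. Consider the semidefinite program $$\min_{X} \ \operatorname{trace}(C^\top X) \quad \text{subject to} \quad X \in \mathbb{R}^{md\times md},\ X = X^\top \succeq 0,\ X_{ii} = I_d \text{ for } i = 1,\ldots,m. \tag{P}$$ Then: 1. $P$ has exactly one real principal $m$-th root $P^{1/m}$, that is, exactly one real matrix $R$ such that $R^m = P$ and every complex eigenvalue $z$ of $R$ satisfies $z \neq 0$ and $|\arg z| < \pi/m$. 2. (P) has exactly one solution $X$, and $\operatorname{rank}(X) = d$. 3. Explicitly, let $Q_m = H_{m,1}$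 and $Q_i = H_{i,i+1} Q_{i+1}$ for $i = m-1,\ldots,1$, and let $Y_m = I_d$ and $Y_i = Q_i P^{-1/m} Q_i^\top H_{i,i+1} Y_{i+1}$ for $i = m-1, \ldots, 1$. Then for all $i, j$ in $\{1,\ldots,m\}$, $$X_{ij} = Y_i Y_j^\top = Q_i P^{(i-j)/m} Q_j^\top .$$ -/

import Mathlib

noncomputable section

namespace CycleSync

/-- Matrices of size `n × n` with `n = m d`, seen as `m × m` arrays of `d × d` blocks. -/
abbrev BlockMatrix (m d : ℕ) := Matrix (Fin m × Fin d) (Fin m × Fin d) ℝ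

/-- The block `X_{ij}`. -/
def block {m d : ℕ} (X : BlockMatrix m d) (i j : Fin m) : Matrix (Fin d) (Fin d) ℝ :=
  X.submatrix (fun a => (i, a)) (fun b => (j, b))

/-- The search space: positive semidefinite matrices whose diagonal blocks are all `I_d`. -/
def feasibleSet (m d : ℕ) : Set (BlockMatrix m d) :=
  {X | X.PosSemidef ∧ ∀ i, block X i i = 1}

/-- `X` solves the semidefinite program: minimize `⟨C, X⟩ = trace (Cᵀ X)` over the search space. -/
def IsSolution {m d : ℕ} (C X : BlockMatrix m d) : Prop :=
  X ∈ feasibleSet m d ∧ IsMinOn (fun Z => (C.transpose * Z).trace) (feasibleSet m d) X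

/-- The cost matrix of the cycle. Here `H i` is the measurement on the edge from `i` to its cyclic
successor `finRotate m i`. For `m ≥ 3` at most one of the two summands is nonzero. -/
def cycleCost {m d : ℕ} (H : Fin m → Matrix (Fin d) (Fin d) ℝ) : BlockMatrix m d :=
  -Matrix.of fun p q =>
    (if q.1 = finRotate m p.1 then H p.1 p.2 q.2 else 0) +
    (if p.1 = finRotate m q.1 then H q.1 q.2 p.2 else 0)

/-- The ordered product of all measurements along the cycle. -/
def cycleProduct {m d : ℕ} (H : Fin m → Matrix (Fin d) (Fin d) ℝ) : Matrix (Fin d) (Fin d) ℝ :=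
  (List.ofFn H).prod

/-- `R` is a principal `m`-th root of `A`: `R ^ m = A` and all complex eigenvalues of `R` lie in the
open sector `{z ≠ 0 : |arg z| < π / m}`. -/
def IsPrincipalRoot {d : ℕ} (m : ℕ) (A R : Matrix (Fin d) (Fin d) ℝ) : Prop :=
  R ^ m = A ∧ ∀ z ∈ spectrum ℂ (R.map Complex.ofReal), z ≠ 0 ∧ |z.arg| < Real.pi / m

/-- Partial products: `Q_i = H_i` at the last index, and `Q_i = H_i Q_{i+1}` before it. -/
def cycleQ {m d : ℕ} (H : Fin m → Matrix (Fin d) (Fin d) ℝ) (i : Fin m) :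
    Matrix (Fin d) (Fin d) ℝ :=
  if h : i.val + 1 < m then H i * cycleQ H ⟨i.val + 1, h⟩ else H i
termination_by m - i.val

/-- `Y_i = I` at the last index, and `Y_i = Q_i R⁻¹ Q_iᵀ H_i Y_{i+1}` before it. -/
def cycleY {m d : ℕ} (H : Fin m → Matrix (Fin d) (Fin d) ℝ) (R : Matrix (Fin d) (Fin d) ℝ)
    (i : Fin m) : Matrix (Fin d) (Fin d) ℝ :=
  if h : i.val + 1 < m then
    cycleQ H i * R⁻¹ * (cycleQ H i).transpose * H i * cycleY H R ⟨i.val + 1, h⟩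
  else 1
termination_by m - i.val

/-- The blocks `Y_1, …, Y_m` on top of each other. -/
def cycleStack {m d : ℕ} (H : Fin m → Matrix (Fin d) (Fin d) ℝ) (R : Matrix (Fin d) (Fin d) ℝ) :
    Matrix (Fin m × Fin d) (Fin d) ℝ :=
  Matrix.of fun p b => cycleY H R p.1 p.2 b

end CycleSync

end

/-! Factor a feasible `X` as `W * Wᵀ`; the constraint says that each block row `W_i` is a
co-isometry. In the gauge `Z_i = Q_iᵀ W_i` every measurement becomes the identity except for the
closing condition `Z_m = P Z_0`, and the cost is `-2 ∑ tr(Z_i Z_{i+1}ᵀ)`, a sum over a path of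
length `m`. The natural candidate turns by the same amount at every step: `E_i = R^i Z_0` with `R^m
= P`.

Put `D_i = Z_i - E_i`, which vanishes at both ends of the path. Since `Z_i` and `E_i` are both
co-isometries, the terms linear in `D` can be rewritten as quadratic ones, and `m tr R - ∑ tr(Z_i
Z_{i+1}ᵀ)` equals `½ ∑ tr((R + Rᵀ) D_i D_iᵀ) - ∑ tr(D_i D_{i+1}ᵀ)`. With zero ends, the last sum is
at most `cos(π/m) ∑ tr(D_i D_iᵀ)`, by the spectrum of a path. The eigenvalues of `R` have angles
strictly inside `(-π/m, π/m)`, so `R + Rᵀ > 2 cos(π/m)` and the difference is nonnegative, with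
equality only for `D = 0`. Optimality and uniqueness thus come together, without duality
(`sum_trace_add_deficit_le`, `le_cost_and_rigidity`).

The root is built over `ℂ` by unitary diagonalization; it is real because its conjugate is a
principal root of the same real matrix (`exists_unique_principalRoot`). -/

/-! ### Principal roots of orthogonal matrices -/

open Matrix Polynomial in
/-- Two matrices with the same `m`-th power and spectrum in the open sector of half-angle `π / m`
agree as soon as the power is diagonalizable. -/
theorem Matrix.eq_conj_diagonal_of_pow_eq {n : Type*} [Fintype n] [DecidableEq n] {m : ℕ}
    (hm : m ≠ 0) {U V A : Matrix n n ℂ} (hUV : U * V = 1) (μ : n → ℂ)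
    (hμ : ∀ j, μ j ≠ 0 ∧ |(μ j).arg| < Real.pi / m)
    (hA : A ^ m = U * diagonal (fun j => μ j ^ m) * V)
    (hs : ∀ z ∈ spectrum ℂ A, |z.arg| < Real.pi / m) :
    A = U * diagonal μ * V := by
  have hVU : V * U = 1 := mul_eq_one_comm.mp hUV
  suffices h : A * U = U * diagonal μ by rw [← h, mul_assoc, hUV, mul_one]
  have hAU : A ^ m * U = U * diagonal (fun j => μ j ^ m) := by
    rw [hA, mul_assoc, hVU, mul_one]
  ext a j
  set v : n → ℂ := fun b => U b j with hv
  have hpow : (A ^ m) *ᵥ v = μ j ^ m • v := by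
    ext b
    have := congrFun (congrFun hAU b) j
    rw [mul_diagonal] at this
    simpa [mulVec, dotProduct, Matrix.mul_apply, mul_comm] using this
  -- This is `(X ^ m - μ ^ m) / (X - μ)`. Its value at `A` annihilates `A v - μ v`, so invertibility
  -- of that value makes `v` an eigenvector of `A` itself.
  set p : ℂ[X] := ∑ k ∈ Finset.range m, X ^ k * C (μ j) ^ (m - 1 - k) with hp
  have hpm : p * (X - C (μ j)) = X ^ m - C (μ j) ^ m := by
    rw [hp]; exact (Commute.all _ _).geom_sum₂_mul m
  have hunit : IsUnit (aeval A p) := by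
    by_contra hcon
    have hne : Nonempty n := ⟨j⟩
    have h0 : (0 : ℂ) ∈ spectrum ℂ (aeval A p) := by rwa [spectrum.zero_mem_iff]
    rw [spectrum.map_polynomial_aeval_of_nonempty A p
      (spectrum.nonempty_of_isAlgClosed_of_finiteDimensional ℂ A)] at h0
    obtain ⟨z, hz, hz0⟩ := h0
    have hzm : z ^ m = μ j ^ m := by
      have := congrArg (eval z) hpm
      simp only [eval_mul, hz0, zero_mul] at this
      simpa [sub_eq_zero, eq_comm] using this
    have hzz := abs_lt.mp (hs z hz)
    have hmm := abs_lt.mp (hμ j).2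
    -- The principal branch of the `m`-th root inverts `z ↦ z ^ m` on the sector. A root of `p` in
    -- the spectrum would therefore be `μ j`, where `p` takes the value `m * μ j ^ (m - 1) ≠ 0`.
    have hzμ : z = μ j := by
      rw [← Complex.pow_cpow_nat_inv hm hzz.1 hzz.2.le, hzm,
        Complex.pow_cpow_nat_inv hm hmm.1 hmm.2.le]
    have : eval (μ j) p = m * μ j ^ (m - 1) := by
      rw [hp, eval_finsetSum]
      rw [Finset.sum_congr rfl (g := fun _ => μ j ^ (m - 1))]
      · simp
      · intro k hk
        simp only [eval_mul, eval_pow, eval_X, eval_C, ← pow_add]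
        congr 1
        have := Finset.mem_range.mp hk
        omega
    have hz0' : eval (μ j) p = 0 := hzμ ▸ hz0
    rw [this] at hz0'
    exact mul_ne_zero (Nat.cast_ne_zero.mpr hm) (pow_ne_zero _ (hμ j).1) hz0'
  have hker : aeval A p *ᵥ (A *ᵥ v - μ j • v) = 0 := by
    have h1 : aeval A (p * (X - C (μ j))) *ᵥ v = aeval A (X ^ m - C (μ j ^ m)) *ᵥ v := by
      rw [hpm, C_pow]
    simpa only [map_mul, map_sub, aeval_X_pow, aeval_X, aeval_C, ← mulVec_mulVec, sub_mulVec, hpow,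
      Algebra.algebraMap_eq_smul_one, smul_mulVec, one_mulVec, sub_self] using h1
  have hz : A *ᵥ v - μ j • v = 0 := by
    obtain ⟨B, hB⟩ := hunit.exists_left_inv
    rw [← one_mulVec (A *ᵥ v - μ j • v), ← hB, ← mulVec_mulVec, hker, mulVec_zero]
  have := congrFun (sub_eq_zero.mp hz) a
  rw [mul_diagonal]
  simpa [mulVec, dotProduct, Matrix.mul_apply, mul_comm, hv] using this

open Matrix in
/-- A unitary matrix for which `-1` is not an eigenvalue is unitarily diagonalizable, with
eigenvalues `exp (i θ)`, `|θ| < π`. (Its Cayley transform is Hermitian.) -/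
theorem Matrix.exists_diagonalization_of_isUnit_one_add {n : Type*} [Fintype n] [DecidableEq n]
    {P : Matrix n n ℂ} (hP : Pᴴ * P = 1) (hu : IsUnit (1 + P)) :
    ∃ (U : Matrix n n ℂ) (θ : n → ℝ), U * Uᴴ = 1 ∧ (∀ j, |θ j| < Real.pi) ∧
      P = U * diagonal (fun j => Complex.exp (θ j * Complex.I)) * Uᴴ := by
  have hP' : P * Pᴴ = 1 := mul_eq_one_comm.mp hP
  obtain ⟨B, hB⟩ := hu.exists_right_inv
  have hB' : B * (1 + P) = 1 := mul_eq_one_comm.mp hB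
  have hBH : Bᴴ = P * B := by
    have h1 : (1 + Pᴴ) * (P * B) = 1 := by
      rw [← mul_assoc, add_mul, hP, one_mul, add_comm, hB]
    have h2 : Bᴴ * (1 + Pᴴ) = 1 := by
      simpa only [conjTranspose_mul, conjTranspose_add, conjTranspose_one] using
        congrArg conjTranspose hB
    exact left_inv_eq_right_inv h2 h1
  have hcomm : P * B = B * P := by
    have h1 : B + P * B = 1 := by rw [← hB, add_mul, one_mul]
    have h2 : B + B * P = 1 := by rw [← hB', mul_add, mul_one]
    exact add_left_cancel (h1.trans h2.symm)
  set K : Matrix n n ℂ := Complex.I • ((1 - P) * B) with hK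
  have hKH : K.IsHermitian := by
    unfold Matrix.IsHermitian
    rw [hK, conjTranspose_smul, conjTranspose_mul, hBH]
    simp only [conjTranspose_sub, conjTranspose_one, Complex.star_def, Complex.conj_I]
    have : P * B * (1 - Pᴴ) = -((1 - P) * B) := by
      rw [mul_sub, mul_one, hcomm, mul_assoc, hP', sub_mul, one_mul, hcomm, mul_one]; abel
    rw [this]; simp
  -- Inverse Cayley transform: an eigenbasis of `K` with eigenvalues `t` diagonalizes `P` with
  -- eigenvalues `(1 + i t) / (1 - i t)`.
  have hcay : (1 - Complex.I • K) * P = 1 + Complex.I • K := by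
    have h1 : Complex.I • K = -((1 - P) * B) := by
      rw [hK, smul_smul, Complex.I_mul_I, neg_one_smul]
    have h3 : 1 - Complex.I • K = 2 • B := by
      rw [h1, sub_neg_eq_add]; nth_rewrite 1 [← hB]; noncomm_ring
    have h4 : 1 + Complex.I • K = 2 • (P * B) := by
      rw [h1]; nth_rewrite 1 [← hB]; noncomm_ring
    rw [h3, h4, smul_mul_assoc, hcomm]
  set U : Matrix n n ℂ := (hKH.eigenvectorUnitary : Matrix n n ℂ) with hU
  have hUU : U * Uᴴ = 1 := Unitary.coe_mul_star_self hKH.eigenvectorUnitary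
  have hUU' : Uᴴ * U = 1 := mul_eq_one_comm.mp hUU
  set t : n → ℝ := hKH.eigenvalues with ht
  have hspec : K = U * diagonal (fun j => (t j : ℂ)) * Uᴴ := by
    have := hKH.spectral_theorem
    rw [Unitary.conjStarAlgAut_apply] at this
    exact this
  set S := Uᴴ * P * U with hS
  have hdiag : (1 - Complex.I • diagonal (fun j => (t j : ℂ))) * S =
      1 + Complex.I • diagonal (fun j => (t j : ℂ)) := by
    have h1 : Uᴴ * ((1 - Complex.I • K) * P) * U = Uᴴ * (1 + Complex.I • K) * U := by rw [hcay]
    have hD : Uᴴ * K * U = diagonal (fun j => (t j : ℂ)) := by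
      rw [hspec]
      calc _ = (Uᴴ * U) * diagonal (fun j => (t j : ℂ)) * (Uᴴ * U) := by simp only [mul_assoc]
        _ = _ := by rw [hUU', one_mul, mul_one]
    have h2 : Uᴴ * ((1 - Complex.I • K) * P) * U = (Uᴴ * (1 - Complex.I • K) * U) * S := by
      rw [hS]
      calc _ = Uᴴ * (1 - Complex.I • K) * 1 * P * U := by simp only [mul_assoc, mul_one]
        _ = _ := by rw [← hUU]; simp only [mul_assoc]
    rw [h2, mul_sub, sub_mul, mul_add, add_mul, mul_one, hUU', mul_smul_comm, smul_mul_assoc,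
      hD] at h1
    exact h1
  have hne : ∀ j, (1 : ℂ) - Complex.I * t j ≠ 0 := by
    intro j h
    have := congrArg Complex.re h
    simp at this
  set ev : n → ℂ := fun j => (1 + Complex.I * t j) / (1 - Complex.I * t j) with hev
  have hSd : S = diagonal ev := by
    ext a b
    have h1 := congrFun (congrFun hdiag a) b
    have e1 : (1 - Complex.I • diagonal (fun j => (t j : ℂ))) =
        diagonal (fun j => 1 - Complex.I * t j) := by
      ext a b; by_cases h : a = b <;> simp [h, diagonal]
    rw [e1, diagonal_mul] at h1
    by_cases h : a = b
    · subst h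
      simp only [diagonal_apply_eq, hev]
      rw [eq_div_iff (hne a), mul_comm, h1]
      simp
    · rw [diagonal_apply_ne _ h]
      simp [h] at h1
      exact h1.resolve_left (hne a)
  have hnorm : ∀ j, ‖ev j‖ = 1 := by
    intro j
    have : (1 : ℂ) + Complex.I * t j = (starRingEnd ℂ) (1 - Complex.I * t j) := by
      simp
    simp only [hev]
    rw [this, norm_div, Complex.norm_conj, div_self (norm_ne_zero_iff.mpr (hne j))]
  refine ⟨U, fun j => (ev j).arg, hUU, fun j => ?_, ?_⟩
  -- Argument `π` would mean `1 + i t = -(1 - i t)`, whose real parts are `1` and `-1`.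
  · refine lt_of_le_of_ne (Complex.abs_arg_le_pi _) fun h => ?_
    have hpi : (ev j).arg = Real.pi := by
      rcases abs_eq Real.pi_pos.le |>.mp h with h | h
      · exact h
      · exact absurd h (Complex.neg_pi_lt_arg _).ne'
    have h1 := Complex.norm_mul_exp_arg_mul_I (ev j)
    rw [hnorm, hpi, Complex.exp_pi_mul_I] at h1
    simp only [hev] at h1
    rw [eq_div_iff (hne j)] at h1
    have := congrArg Complex.re h1
    simp at this
    norm_num at this
  · have : (fun j => Complex.exp (((ev j).arg : ℝ) * Complex.I)) = ev := by
      funext j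
      have h1 := Complex.norm_mul_exp_arg_mul_I (ev j)
      rwa [hnorm, Complex.ofReal_one, one_mul] at h1
    rw [this, ← hSd, hS]
    calc P = (U * Uᴴ) * P * (U * Uᴴ) := by rw [hUU, one_mul, mul_one]
      _ = _ := by simp only [mul_assoc]

open Matrix in
theorem Matrix.exists_eq_of_mem_spectrum_conj_diagonal {n : Type*} [Fintype n] [DecidableEq n]
    {U V : Matrix n n ℂ} (hUV : U * V = 1) (μ : n → ℂ) {z : ℂ}
    (hz : z ∈ spectrum ℂ (U * diagonal μ * V)) : ∃ j, z = μ j := by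
  have hVU : V * U = 1 := mul_eq_one_comm.mp hUV
  have h := spectrum.units_conjugate (R := ℂ) (a := diagonal μ) (u := ⟨U, V, hUV, hVU⟩)
  have h' : spectrum ℂ (U * diagonal μ * V) = spectrum ℂ (diagonal μ) := h
  rw [h', spectrum_diagonal] at hz
  obtain ⟨j, hj⟩ := hz
  exact ⟨j, hj.symm⟩

open Matrix ComplexOrder in
theorem Matrix.posDef_of_map_ofReal {n : Type*} [Fintype n] [DecidableEq n] {M : Matrix n n ℝ}
    (hM : (M.map Complex.ofReal).PosDef) : M.PosDef := by
  refine PosDef.of_dotProduct_mulVec_pos ?_ fun x hx => ?_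
  · ext a b
    have := congrFun (congrFun hM.isHermitian a) b
    simpa using this
  · have hx' : (fun a => (x a : ℂ)) ≠ 0 := fun h => hx <| by
      ext a; simpa using congrFun h a
    have h := hM.dotProduct_mulVec_pos hx'
    have e : star (fun a => (x a : ℂ)) ⬝ᵥ (M.map Complex.ofReal *ᵥ fun a => (x a : ℂ)) =
        ((star x ⬝ᵥ (M *ᵥ x) : ℝ) : ℂ) := by
      simp [dotProduct, mulVec]
    rw [e] at h
    exact_mod_cast h

open Matrix in
theorem Matrix.isUnit_one_add_map_ofReal {d : ℕ} {P : Matrix (Fin d) (Fin d) ℝ}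
    (h : ¬ Module.End.HasEigenvalue (Matrix.toLin' P) (-1)) :
    IsUnit (1 + P.map Complex.ofReal) := by
  have h1 : IsUnit (1 + P) := by
    rw [isUnit_iff_isUnit_det, isUnit_iff_ne_zero]
    intro h0
    obtain ⟨v, hv, hv0⟩ := exists_mulVec_eq_zero_iff.mpr h0
    refine h (Module.End.hasEigenvalue_of_hasEigenvector (x := v) ?_)
    rw [Module.End.hasEigenvector_iff, Module.End.mem_eigenspace_iff]
    refine ⟨?_, hv⟩
    rw [add_mulVec, one_mulVec] at hv0
    rw [toLin'_apply, neg_one_smul]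
    exact (neg_eq_of_add_eq_zero_right hv0).symm
  have h2 := h1.map (Complex.ofRealHom.mapMatrix (m := Fin d))
  rwa [map_add, map_one] at h2

open Matrix ComplexOrder in
/-- A real orthogonal matrix without eigenvalue `-1` has exactly one real principal `m`-th root.
It is orthogonal, and its symmetric part is larger than `cos (π / m)`. -/
theorem CycleSync.exists_unique_principalRoot {d m : ℕ} (hm : m ≠ 0)
    {P : Matrix (Fin d) (Fin d) ℝ} (hP : Pᵀ * P = 1)
    (hev : ¬ Module.End.HasEigenvalue (Matrix.toLin' P) (-1)) :
    ∃ R : Matrix (Fin d) (Fin d) ℝ, (∀ R', IsPrincipalRoot m P R' ↔ R' = R) ∧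
      R * Rᵀ = 1 ∧ R ^ m = P ∧
      (R + Rᵀ - (2 * Real.cos (Real.pi / m)) • (1 : Matrix (Fin d) (Fin d) ℝ)).PosDef := by
  have hm0 : (0 : ℝ) < m := by positivity
  have hm1 : (1 : ℝ) ≤ m := by exact_mod_cast Nat.one_le_iff_ne_zero.mpr hm
  set Pc : Matrix (Fin d) (Fin d) ℂ := P.map Complex.ofReal with hPc
  have hinj : Function.Injective (fun A : Matrix (Fin d) (Fin d) ℝ => A.map Complex.ofReal) :=
    Matrix.map_injective Complex.ofReal_injective
  have map_mul' : ∀ A B : Matrix (Fin d) (Fin d) ℝ, (A * B).map Complex.ofReal =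
      A.map Complex.ofReal * B.map Complex.ofReal := fun A B =>
    map_mul (Complex.ofRealHom.mapMatrix (m := Fin d)) A B
  have map_pow' : ∀ (A : Matrix (Fin d) (Fin d) ℝ) (k : ℕ), (A ^ k).map Complex.ofReal =
      A.map Complex.ofReal ^ k := fun A k =>
    map_pow (Complex.ofRealHom.mapMatrix (m := Fin d)) A k
  have map_one' : (1 : Matrix (Fin d) (Fin d) ℝ).map Complex.ofReal = 1 :=
    map_one (Complex.ofRealHom.mapMatrix (m := Fin d))
  have map_star' : ∀ A : Matrix (Fin d) (Fin d) ℝ, (Aᵀ).map Complex.ofReal =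
      (A.map Complex.ofReal)ᴴ := fun A => by ext a b; simp
  have hPu : Pcᴴ * Pc = 1 := by rw [← map_star', ← map_mul', hP, map_one']
  obtain ⟨U, θ, hU, hθ, hPU⟩ :=
    exists_diagonalization_of_isUnit_one_add hPu (isUnit_one_add_map_ofReal hev)
  have hU' : Uᴴ * U = 1 := mul_eq_one_comm.mp hU
  set φ : Fin d → ℝ := fun j => θ j / m with hφ
  have hφm : ∀ j, |φ j| < Real.pi / m := fun j => by
    rw [hφ, abs_div, abs_of_pos hm0]; gcongr; exact hθ j
  have hle : Real.pi / m ≤ Real.pi := div_le_self Real.pi_pos.le hm1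
  set μ : Fin d → ℂ := fun j => Complex.exp (φ j * Complex.I) with hμ
  have harg : ∀ j, (μ j).arg = φ j := fun j => by
    have := abs_lt.mp (hφm j)
    simp only [hμ]
    rw [Complex.arg_exp, Complex.im_ofReal_mul, Complex.I_im, mul_one, toIocMod_eq_self]
    exact ⟨by linarith, by linarith⟩
  have hμs : ∀ j, μ j ≠ 0 ∧ |(μ j).arg| < Real.pi / m := fun j =>
    ⟨Complex.exp_ne_zero _, by rw [harg]; exact hφm j⟩
  have hμm : (fun j => μ j ^ m) = fun j => Complex.exp (θ j * Complex.I) := by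
    funext j
    rw [hμ, ← Complex.exp_nat_mul]
    congr 1
    rw [hφ]; push_cast
    have : (m : ℂ) ≠ 0 := Nat.cast_ne_zero.mpr hm
    field_simp
  have hPU' : Pc = U * diagonal (fun j => μ j ^ m) * Uᴴ := by rw [hμm]; exact hPU
  set Rc := U * diagonal μ * Uᴴ with hRc
  have hRm : Rc ^ m = Pc := by
    have h : ∀ k : ℕ, Rc ^ k = U * diagonal μ ^ k * Uᴴ := by
      intro k
      induction k with
      | zero => simp [hU]
      | succ k ih =>
        rw [pow_succ, ih, hRc, pow_succ]
        calc _ = U * diagonal μ ^ k * (Uᴴ * U) * diagonal μ * Uᴴ := by simp only [mul_assoc]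
          _ = _ := by rw [hU', mul_one]; simp only [mul_assoc]
    rw [h, diagonal_pow, hPU']; rfl
  have huniq : ∀ A : Matrix (Fin d) (Fin d) ℂ, A ^ m = Pc →
      (∀ z ∈ spectrum ℂ A, |z.arg| < Real.pi / m) → A = Rc := fun A hA hs =>
    eq_conj_diagonal_of_pow_eq hm hU μ hμs (hA.trans hPU') hs
  set cj : Matrix (Fin d) (Fin d) ℂ →+* Matrix (Fin d) (Fin d) ℂ :=
    (starRingEnd ℂ).mapMatrix with hcj
  -- `P` is real and the sector is stable under conjugation, so uniqueness forces the root to be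
  -- real.
  have hconj : cj Rc = Rc := by
    refine huniq _ ?_ ?_
    · rw [← map_pow, hRm]
      ext a b
      simp [hcj, hPc]
    · intro z hz
      have hd : cj (diagonal μ) = diagonal fun j => (starRingEnd ℂ) (μ j) := by
        simp only [hcj, RingHom.mapMatrix_apply]
        rw [diagonal_map (map_zero _)]
      rw [hRc, map_mul, map_mul, hd] at hz
      obtain ⟨j, rfl⟩ := exists_eq_of_mem_spectrum_conj_diagonal
        (by rw [← map_mul, hU, map_one]) _ hz
      rw [Complex.arg_conj]
      split_ifs with h
      · have := (hμs j).2; rwa [h] at this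
      · rw [abs_neg]; exact (hμs j).2
  set R : Matrix (Fin d) (Fin d) ℝ := Rc.map Complex.re with hR
  have hRR : R.map Complex.ofReal = Rc := by
    ext a b
    have := congrFun (congrFun hconj a) b
    exact Complex.conj_eq_iff_re.mp this
  have hRH : Rcᴴ = U * diagonal (fun j => star (μ j)) * Uᴴ := by
    rw [hRc, conjTranspose_mul, conjTranspose_mul, diagonal_conjTranspose,
      conjTranspose_conjTranspose, mul_assoc]; rfl
  have hRp : R ^ m = P := hinj <| by
    change (R ^ m).map _ = P.map _
    rw [map_pow', hRR, hRm]
  refine ⟨R, fun R' => ⟨fun h => hinj ?_, ?_⟩, hinj ?_, hRp, posDef_of_map_ofReal ?_⟩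
  · change R'.map _ = R.map _
    rw [hRR]
    exact huniq _ (by rw [← map_pow', h.1]) fun z hz => (h.2 z hz).2
  · rintro rfl
    refine ⟨hRp, fun z hz => ?_⟩
    rw [hRR] at hz
    obtain ⟨j, rfl⟩ := exists_eq_of_mem_spectrum_conj_diagonal hU _ hz
    exact hμs j
  · change (R * Rᵀ).map _ = Matrix.map 1 _
    rw [map_mul', map_star', map_one', hRR, hRH, hRc]
    calc _ = U * diagonal μ * (Uᴴ * U) * diagonal (fun j => star (μ j)) * Uᴴ := by
          simp only [mul_assoc]
      _ = U * (diagonal μ * diagonal (fun j => star (μ j))) * Uᴴ := by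
          rw [hU', mul_one]; simp only [mul_assoc]
      _ = 1 := by
          rw [diagonal_mul_diagonal]
          have : (fun j => μ j * star (μ j)) = 1 := by
            funext j
            rw [Complex.star_def, Complex.mul_conj, Complex.normSq_eq_norm_sq, hμ,
              Complex.norm_exp_ofReal_mul_I]
            simp
          rw [this, diagonal_one', mul_one, hU]
  · set c : ℝ := 2 * Real.cos (Real.pi / m) with hc
    have e : (R + Rᵀ - c • (1 : Matrix (Fin d) (Fin d) ℝ)).map Complex.ofReal =
        U * diagonal (fun j => ((2 * Real.cos (φ j) - c : ℝ) : ℂ)) * Uᴴ := by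
      have e1 : (R + Rᵀ - c • (1 : Matrix (Fin d) (Fin d) ℝ)).map Complex.ofReal =
          Rc + Rcᴴ - (c : ℂ) • 1 := by
        rw [← hRR, ← map_star', ← map_one']
        ext a b
        simp only [map_apply, Matrix.sub_apply, Matrix.add_apply, Matrix.smul_apply, smul_eq_mul]
        push_cast
        rfl
      have e2 : (c : ℂ) • (1 : Matrix (Fin d) (Fin d) ℂ) = U * ((c : ℂ) • 1) * Uᴴ := by
        rw [mul_smul_comm, mul_one, smul_mul_assoc, hU]
      rw [e1, hRH, hRc, e2, ← add_mul, ← mul_add, ← sub_mul, ← mul_sub]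
      congr 2
      ext a b
      by_cases h : a = b
      · subst h
        have : μ a + star (μ a) = 2 * Complex.cos (φ a) := by
          rw [Complex.star_def, Complex.add_conj, hμ, Complex.exp_ofReal_mul_I_re]
          push_cast; rfl
        simpa using this
      · simp [h]
    rw [e]
    refine PosDef.mul_mul_conjTranspose_same (PosDef.diagonal fun j => ?_) ?_
    · have h1 : Real.cos (Real.pi / m) < Real.cos (φ j) := by
        rw [← Real.cos_abs (φ j)]
        exact Real.cos_lt_cos_of_nonneg_of_le_pi (abs_nonneg _) hle (hφm j)
      have : 0 < 2 * Real.cos (φ j) - c := by rw [hc]; linarith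
      exact_mod_cast this
    · exact vecMul_injective_of_isUnit ⟨⟨U, Uᴴ, hU, hU'⟩, rfl⟩

/-! ### Trace inequalities and the cyclic correlation bound -/

open Matrix

theorem Matrix.trace_mul_transpose_self_nonneg {n N : Type*} [Fintype n] [Fintype N]
    (A : Matrix n N ℝ) : 0 ≤ (A * Aᵀ).trace := by
  simpa using (posSemidef_self_mul_conjTranspose A).trace_nonneg

theorem Matrix.trace_mul_transpose_comm {n N : Type*} [Fintype n] [Fintype N]
    (A B : Matrix n N ℝ) : (B * Aᵀ).trace = (A * Bᵀ).trace := by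
  rw [← trace_transpose, transpose_mul, transpose_transpose]

/-- Expand the squared norm of `b A - a B` and divide by `a b`. The weights will be consecutive
entries of a positive eigenvector of the path. -/
theorem Matrix.two_mul_trace_mul_transpose_le {n N : Type*} [Fintype n] [Fintype N]
    (A B : Matrix n N ℝ) {a b : ℝ} (ha : 0 < a) (hb : 0 < b) :
    2 * (A * Bᵀ).trace ≤ b / a * (A * Aᵀ).trace + a / b * (B * Bᵀ).trace := by
  have h := trace_mul_transpose_self_nonneg (b • A - a • B)
  simp only [transpose_sub, transpose_smul, Matrix.sub_mul, Matrix.mul_sub, Matrix.smul_mul, Matrix.mul_smul,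
    trace_sub, trace_smul, smul_eq_mul, trace_mul_transpose_comm A B] at h
  have e : b / a * (A * Aᵀ).trace + a / b * (B * Bᵀ).trace - 2 * (A * Bᵀ).trace =
      (b * (b * (A * Aᵀ).trace - a * (A * Bᵀ).trace) -
        a * (b * (A * Bᵀ).trace - a * (B * Bᵀ).trace)) / (a * b) := by
    field_simp
    ring
  have := div_nonneg h (mul_pos ha hb).le
  linarith

/-- The largest eigenvalue of a path on `m - 1` vertices is `2 cos (π / m)`. -/
theorem Matrix.sum_trace_mul_transpose_succ_le {n N : Type*} [Fintype n] [Fintype N] {m : ℕ}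
    (hm : 2 ≤ m) (D : ℕ → Matrix n N ℝ) (h0 : D 0 = 0) (hDm : D m = 0) :
    2 * ∑ i ∈ Finset.range m, (D i * (D (i + 1))ᵀ).trace ≤
      2 * Real.cos (Real.pi / m) * ∑ i ∈ Finset.range m, (D i * (D i)ᵀ).trace := by
  have hm0 : (0 : ℝ) < m := by positivity
  -- The Perron eigenvector of the path: positive at the interior vertices, zero at `0` and `m`.
  set s : ℝ → ℝ := fun x => Real.sin (x * (Real.pi / m)) with hs
  have hpos : ∀ i : ℕ, 0 < i → i < m → 0 < s i := by
    intro i hi him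
    have h1 : (0 : ℝ) < i := by exact_mod_cast hi
    have h2 : (i : ℝ) < m := by exact_mod_cast him
    refine Real.sin_pos_of_pos_of_lt_pi (by positivity) ?_
    rw [← mul_div_assoc, div_lt_iff₀ hm0, mul_comm]
    gcongr
  have hrec : ∀ x, s (x + 1) + s (x - 1) = 2 * Real.cos (Real.pi / m) * s x := by
    intro x
    simp only [hs, add_mul, sub_mul, one_mul, Real.sin_add, Real.sin_sub]
    ring
  -- The share of the edge `(k - 1, k)` charged to its right endpoint. The divisions by `s 0 = s m =
  -- 0` are harmless, as `D` vanishes there.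
  set f : ℕ → ℝ := fun k => s (k - 1) / s k * (D k * (D k)ᵀ).trace with hf
  have hstep : ∀ i ∈ Finset.range m, 2 * (D i * (D (i + 1))ᵀ).trace ≤
      s (i + 1) / s i * (D i * (D i)ᵀ).trace + f (i + 1) := by
    intro i hi
    have him := Finset.mem_range.mp hi
    rcases Nat.eq_zero_or_pos i with rfl | hi0
    · simp [h0, hf, hs]
    · rcases Nat.lt_or_ge (i + 1) m with h1 | h1
      · have := two_mul_trace_mul_transpose_le (D i) (D (i + 1)) (hpos i hi0 him)
          (hpos (i + 1) (by omega) h1)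
        simpa [hf] using this
      · have e : i + 1 = m := by omega
        have e' : (i : ℝ) + 1 = m := by exact_mod_cast e
        have hsm : s m = 0 := by
          simp only [hs]
          rw [mul_div_cancel₀ _ hm0.ne', Real.sin_pi]
        rw [e, e', hDm, hsm]
        simp [hf, hDm]
  -- Regrouping the charges by vertex gives the coefficient `(s (i + 1) + s (i - 1)) / s i = 2 cos
  -- (π / m)`.
  have hshift : ∑ i ∈ Finset.range m, f (i + 1) = ∑ i ∈ Finset.range m, f i := by
    have h1 := Finset.sum_range_succ f m
    have h2 := Finset.sum_range_succ' f m
    have e0 : f 0 = 0 := by simp [hf, h0]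
    have em : f m = 0 := by simp [hf, hDm]
    linarith
  calc 2 * ∑ i ∈ Finset.range m, (D i * (D (i + 1))ᵀ).trace
      ≤ ∑ i ∈ Finset.range m, (s (i + 1) / s i * (D i * (D i)ᵀ).trace + f (i + 1)) := by
        rw [Finset.mul_sum]; exact Finset.sum_le_sum hstep
    _ = ∑ i ∈ Finset.range m, (s (i + 1) / s i * (D i * (D i)ᵀ).trace + f i) := by
        rw [Finset.sum_add_distrib, hshift, Finset.sum_add_distrib]
    _ = _ := by
        rw [Finset.mul_sum]
        refine Finset.sum_congr rfl fun i hi => ?_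
        rcases Nat.eq_zero_or_pos i with rfl | hi0
        · simp [h0, hf]
        · have hp := (hpos i hi0 (Finset.mem_range.mp hi)).ne'
          simp only [hf]
          rw [← add_mul, ← add_div, hrec, mul_div_assoc, div_self hp, mul_one]

theorem Matrix.PosDef.trace_mul_mul_transpose_nonneg {n N : Type*} [Fintype n] [Fintype N]
    {M : Matrix n n ℝ} (hM : M.PosDef) (D : Matrix n N ℝ) : 0 ≤ (M * (D * Dᵀ)).trace := by
  rw [← Matrix.mul_assoc, trace_mul_comm, ← Matrix.mul_assoc]
  simpa using (hM.posSemidef.conjTranspose_mul_mul_same D).trace_nonneg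

/-- The trace is that of the positive semidefinite `Dᵀ M D`, which must then vanish; its diagonal
entries are the values of the form `M` at the columns of `D`. -/
theorem Matrix.PosDef.eq_zero_of_trace_mul_mul_transpose_eq_zero {n N : Type*} [Fintype n]
    [Fintype N] {M : Matrix n n ℝ} (hM : M.PosDef) {D : Matrix n N ℝ}
    (h : (M * (D * Dᵀ)).trace = 0) : D = 0 := by
  classical
  rw [← Matrix.mul_assoc, trace_mul_comm, ← Matrix.mul_assoc] at h
  have hps := hM.posSemidef.conjTranspose_mul_mul_same D
  rw [conjTranspose_eq_transpose_of_trivial] at hps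
  have hz := (hps.trace_eq_zero_iff).mp h
  ext a b
  by_contra hne
  have hc : (fun a => D a b) ≠ 0 := fun h => hne (congrFun h a)
  have := hM.dotProduct_mulVec_pos hc
  have e : star (fun a => D a b) ⬝ᵥ (M *ᵥ fun a => D a b) = (Dᵀ * M * D) b b := by
    rw [Matrix.mul_assoc]; rfl
  rw [e, hz] at this
  exact lt_irrefl _ this

/-- The cyclic correlation bound: for `m` co-isometries `Z i` closed up by `Z m = R ^ m Z 0`, the
total correlation is at most `m` times the trace of `R`, with an explicit deficit. -/
theorem Matrix.sum_trace_add_deficit_le {n N : Type*} [Fintype n] [DecidableEq n] [Fintype N]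
    {m : ℕ} (hm : 2 ≤ m) {R : Matrix n n ℝ} (hR : R * Rᵀ = 1) (Z : ℕ → Matrix n N ℝ)
    (hZ : ∀ i ≤ m, Z i * (Z i)ᵀ = 1) (hZm : Z m = R ^ m * Z 0) :
    ∑ i ∈ Finset.range m, (Z i * (Z (i + 1))ᵀ).trace +
      1 / 2 * ∑ i ∈ Finset.range m, ((R + Rᵀ - (2 * Real.cos (Real.pi / m)) • (1 : Matrix n n ℝ)) *
        ((Z i - R ^ i * Z 0) * (Z i - R ^ i * Z 0)ᵀ)).trace ≤ m * R.trace := by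
  have hR' : Rᵀ * R = 1 := mul_eq_one_comm.mp hR
  set E : ℕ → Matrix n N ℝ := fun i => R ^ i * Z 0 with hE
  set D : ℕ → Matrix n N ℝ := fun i => Z i - E i with hD
  have hZD : ∀ i, Z i = D i + E i := fun i => (sub_add_cancel _ _).symm
  have hEs : ∀ i, E (i + 1) = R * E i := fun i => by simp only [hE, pow_succ', Matrix.mul_assoc]
  have hEs' : ∀ i, E i = Rᵀ * E (i + 1) := fun i => by rw [hEs, ← Matrix.mul_assoc, hR', Matrix.one_mul]
  have hEE : ∀ i, E i * (E i)ᵀ = 1 := by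
    intro i
    induction i with
    | zero => simpa [hE] using hZ 0 (Nat.zero_le _)
    | succ i ih =>
      rw [hEs, transpose_mul, Matrix.mul_assoc, ← Matrix.mul_assoc (E i), ih, Matrix.one_mul, hR]
  have hD0 : D 0 = 0 := by simp [hD, hE]
  have hDm : D m = 0 := by simp [hD, hE, hZm]
  set a : ℕ → ℝ := fun i => (Rᵀ * (D i * (E i)ᵀ)).trace with ha
  set b : ℕ → ℝ := fun i => (Rᵀ * (E i * (D i)ᵀ)).trace with hb
  have hterm : ∀ i, (Z i * (Z (i + 1))ᵀ).trace =
      (D i * (D (i + 1))ᵀ).trace + a i + b (i + 1) + R.trace := by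
    intro i
    have e1 : (D i * (E (i + 1))ᵀ).trace = a i := by
      rw [hEs, transpose_mul, ← Matrix.mul_assoc, trace_mul_comm]
    have e2 : (E i * (D (i + 1))ᵀ).trace = b (i + 1) := by
      rw [hEs' i, Matrix.mul_assoc]
    have e3 : (E i * (E (i + 1))ᵀ).trace = R.trace := by
      rw [hEs, transpose_mul, ← Matrix.mul_assoc, hEE, Matrix.one_mul, trace_transpose]
    rw [hZD i, hZD (i + 1), transpose_add, Matrix.add_mul, Matrix.mul_add, Matrix.mul_add, trace_add, trace_add,
      trace_add, e1, e2, e3]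
    ring
  -- Comparing `Z Zᵀ = 1` with `E Eᵀ = 1` gives `D Dᵀ = -(D Eᵀ + E Dᵀ)`, which trades the linear
  -- terms `a`, `b` for a quadratic one.
  have hab : ∀ i ≤ m, ((R + Rᵀ) * (D i * (D i)ᵀ)).trace = -2 * (a i + b i) := by
    intro i hi
    have h1 : D i * (D i)ᵀ = -(D i * (E i)ᵀ + E i * (D i)ᵀ) := by
      have h2 := hZ i hi
      rw [hZD i, transpose_add, Matrix.add_mul, Matrix.mul_add, Matrix.mul_add, hEE] at h2
      have h3 : D i * (D i)ᵀ + (D i * (E i)ᵀ + E i * (D i)ᵀ) = 0 := by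
        have : D i * (D i)ᵀ + (D i * (E i)ᵀ + E i * (D i)ᵀ) =
          (D i * (D i)ᵀ + D i * (E i)ᵀ + (E i * (D i)ᵀ + 1)) - 1 := by abel
        rw [this, h2, sub_self]
      exact eq_neg_of_add_eq_zero_left h3
    have e1 : (R * (D i * (E i)ᵀ)).trace = b i := by
      rw [← trace_transpose, transpose_mul, transpose_mul, transpose_transpose, trace_mul_comm]
    have e2 : (R * (E i * (D i)ᵀ)).trace = a i := by
      rw [← trace_transpose, transpose_mul, transpose_mul, transpose_transpose, trace_mul_comm]
    rw [h1, Matrix.mul_neg, trace_neg, Matrix.add_mul, Matrix.mul_add, Matrix.mul_add, trace_add, trace_add, trace_add, e1, e2]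
    ring
  have hbs : ∑ i ∈ Finset.range m, b (i + 1) = ∑ i ∈ Finset.range m, b i := by
    have h1 := Finset.sum_range_succ b m
    have h2 := Finset.sum_range_succ' b m
    have e0 : b 0 = 0 := by simp [hb, hD0]
    have em : b m = 0 := by simp [hb, hDm]
    linarith
  have hpath := sum_trace_mul_transpose_succ_le hm D hD0 hDm
  have hsum : ∑ i ∈ Finset.range m, (Z i * (Z (i + 1))ᵀ).trace =
      ∑ i ∈ Finset.range m, (D i * (D (i + 1))ᵀ).trace +
        ∑ i ∈ Finset.range m, (a i + b i) + m * R.trace := by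
    simp only [hterm, Finset.sum_add_distrib, hbs, Finset.sum_const, Finset.card_range,
      nsmul_eq_mul]
    ring
  have hdef : ∑ i ∈ Finset.range m, ((R + Rᵀ - (2 * Real.cos (Real.pi / m)) •
      (1 : Matrix n n ℝ)) * (D i * (D i)ᵀ)).trace = -2 * ∑ i ∈ Finset.range m, (a i + b i) -
        2 * Real.cos (Real.pi / m) * ∑ i ∈ Finset.range m, (D i * (D i)ᵀ).trace := by
    rw [Finset.mul_sum, Finset.mul_sum, ← Finset.sum_sub_distrib]
    refine Finset.sum_congr rfl fun i hi => ?_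
    rw [Matrix.sub_mul, trace_sub, hab i (Finset.mem_range.mp hi).le, Matrix.smul_mul, Matrix.one_mul, trace_smul,
      smul_eq_mul]
  change ∑ i ∈ Finset.range m, (Z i * (Z (i + 1))ᵀ).trace +
      1 / 2 * ∑ i ∈ Finset.range m, ((R + Rᵀ - (2 * Real.cos (Real.pi / m)) • (1 : Matrix n n ℝ)) *
        (D i * (D i)ᵀ)).trace ≤ m * R.trace
  rw [hdef, hsum]
  linarith

/-! ### Recursions along the cycle and the cost as a sum over edges -/

namespace CycleSync

theorem cycleQ_of_lt {m d : ℕ} (H : Fin m → Matrix (Fin d) (Fin d) ℝ) (i : Fin m)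
    (h : i.val + 1 < m) : cycleQ H i = H i * cycleQ H ⟨i.val + 1, h⟩ := by
  rw [cycleQ, dif_pos h]

theorem cycleQ_of_not_lt {m d : ℕ} (H : Fin m → Matrix (Fin d) (Fin d) ℝ) (i : Fin m)
    (h : ¬ i.val + 1 < m) : cycleQ H i = H i := by
  rw [cycleQ, dif_neg h]

/-- Backward induction along the cycle. -/
theorem fin_backward_induction {m : ℕ} {p : Fin m → Prop}
    (last : ∀ i : Fin m, ¬ i.val + 1 < m → p i)
    (step : ∀ (i : Fin m) (h : i.val + 1 < m), p ⟨i.val + 1, h⟩ → p i) (i : Fin m) : p i := by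
  obtain ⟨k, hk⟩ : ∃ k, i.val + k + 1 = m := ⟨m - 1 - i.val, by omega⟩
  induction k generalizing i with
  | zero => exact last i (by omega)
  | succ k ih => exact step i (by omega) (ih ⟨i.val + 1, by omega⟩ (by simp only; omega))

theorem cycleQ_mul_transpose {m d : ℕ} {H : Fin m → Matrix (Fin d) (Fin d) ℝ}
    (hH : ∀ i, H i * (H i)ᵀ = 1) (i : Fin m) : cycleQ H i * (cycleQ H i)ᵀ = 1 := by
  induction i using fin_backward_induction with
  | last i h => rw [cycleQ_of_not_lt H i h, hH]
  | step i h ih =>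
    rw [cycleQ_of_lt H i h, transpose_mul, mul_assoc, ← mul_assoc (cycleQ H _), ih, one_mul, hH]

theorem cycleQ_eq_prod_drop {m d : ℕ} (H : Fin m → Matrix (Fin d) (Fin d) ℝ) (i : Fin m) :
    cycleQ H i = ((List.ofFn H).drop i.val).prod := by
  induction i using fin_backward_induction with
  | last i h =>
    rw [cycleQ_of_not_lt H i h, List.drop_eq_getElem_cons (by simp), List.prod_cons,
      List.drop_of_length_le (by simp; omega)]
    simp
  | step i h ih =>
    rw [cycleQ_of_lt H i h, List.drop_eq_getElem_cons (by simp), List.prod_cons, ih]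
    simp

theorem cycleProduct_eq_cycleQ {m d : ℕ} (H : Fin m → Matrix (Fin d) (Fin d) ℝ) (hm : 0 < m) :
    cycleProduct H = cycleQ H ⟨0, hm⟩ := by
  rw [cycleQ_eq_prod_drop]; rfl

/-- Since `Q_iᵀ H_i Q_{i+1} = 1`, the recursion telescopes to powers of `R⁻¹`; the last factor
normalizes the final block to the identity. -/
theorem cycleY_eq {m d : ℕ} {H : Fin m → Matrix (Fin d) (Fin d) ℝ}
    (hH : ∀ i, H i * (H i)ᵀ = 1) (R : Matrix (Fin d) (Fin d) ℝ) (i : Fin m) :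
    cycleY H R i = cycleQ H i * R⁻¹ ^ (m - 1 - i.val) *
      (cycleQ H ⟨m - 1, by have := i.isLt; omega⟩)ᵀ := by
  induction i using fin_backward_induction with
  | last i h =>
    have hi : i = ⟨m - 1, by have := i.isLt; omega⟩ := Fin.ext (by simp only; omega)
    have hk : m - 1 - i.val = 0 := by omega
    rw [cycleY, dif_neg h, hk, pow_zero, mul_one, ← hi, cycleQ_mul_transpose hH]
  | step i h ih =>
    have hk : m - 1 - i.val = (m - 1 - (i.val + 1)) + 1 := by omega
    have hQ : (cycleQ H i)ᵀ * H i * cycleQ H ⟨i.val + 1, h⟩ = 1 := by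
      rw [mul_assoc, ← cycleQ_of_lt H i h]
      exact mul_eq_one_comm.mp (cycleQ_mul_transpose hH i)
    rw [cycleY, dif_pos h, ih, hk, pow_succ']
    calc _ = cycleQ H i * R⁻¹ * ((cycleQ H i)ᵀ * H i * cycleQ H ⟨i.val + 1, h⟩) *
          R⁻¹ ^ (m - 1 - (i.val + 1)) * (cycleQ H ⟨m - 1, by omega⟩)ᵀ := by
          simp only [mul_assoc]
      _ = _ := by rw [hQ, mul_one]; simp only [mul_assoc]

/-- The `i`-th block row of `W`. -/
def blockRow {m d : ℕ} {N : Type*} (W : Matrix (Fin m × Fin d) N ℝ) (i : Fin m) :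
    Matrix (Fin d) N ℝ :=
  W.submatrix (fun a => (i, a)) id

theorem block_mul_transpose {m d : ℕ} {N : Type*} [Fintype N] (W : Matrix (Fin m × Fin d) N ℝ)
    (i j : Fin m) : block (W * Wᵀ) i j = blockRow W i * (blockRow W j)ᵀ := rfl

theorem ext_block {m d : ℕ} {X Z : BlockMatrix m d} (h : ∀ i j, block X i j = block Z i j) :
    X = Z := by
  ext p q
  exact congrFun (congrFun (h p.1 q.1) p.2) q.2

/-- The two orientations of an edge contribute equally because `X` is symmetric, hence the factor
`2`. -/
theorem trace_cycleCost_mul {m d : ℕ} (H : Fin m → Matrix (Fin d) (Fin d) ℝ)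
    {X : BlockMatrix m d} (hX : Xᵀ = X) :
    ((cycleCost H)ᵀ * X).trace = -2 * ∑ i, ((H i)ᵀ * block X i (finRotate m i)).trace := by
  set A : BlockMatrix m d := Matrix.of fun p q =>
    if q.1 = finRotate m p.1 then H p.1 p.2 q.2 else 0 with hA
  have hC : cycleCost H = -(A + Aᵀ) := rfl
  have hAX : (Aᵀ * X).trace = ∑ i, ((H i)ᵀ * block X i (finRotate m i)).trace := by
    simp only [trace, diag_apply, Matrix.mul_apply, transpose_apply, block, submatrix_apply]
    rw [Finset.sum_comm]
    simp only [Fintype.sum_prod_type, hA, of_apply, ite_mul, zero_mul]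
    refine Finset.sum_congr rfl fun i _ => ?_
    rw [Finset.sum_comm' (t' := Finset.univ) (s' := fun _ => Finset.univ) (by simp)]
    rw [Finset.sum_eq_single (finRotate m i)]
    · rw [Finset.sum_comm]; simp
    · intro b _ hb; simp only [if_neg hb, Finset.sum_const_zero]
    · simp
  have hAX' : (A * X).trace = (Aᵀ * X).trace := by
    rw [← trace_transpose, transpose_mul, hX, trace_mul_comm]
  rw [hC, transpose_neg, transpose_add, transpose_transpose, neg_mul, add_mul, trace_neg,
    trace_add, hAX', hAX]
  ring

end CycleSync

/-! ### The gauge, the lower bound and rigidity -/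

namespace CycleSync

/-- The block rows of `W` in the gauge given by the partial products, closed up by the first one. -/
def gaugedRow {m d : ℕ} {N : Type*} (H : Fin m → Matrix (Fin d) (Fin d) ℝ) (hm : 0 < m)
    (W : Matrix (Fin m × Fin d) N ℝ) (k : ℕ) : Matrix (Fin d) N ℝ :=
  if h : k < m then (cycleQ H ⟨k, h⟩)ᵀ * blockRow W ⟨k, h⟩ else blockRow W ⟨0, hm⟩

section

variable {m d : ℕ} {N : Type*} {H : Fin m → Matrix (Fin d) (Fin d) ℝ}

theorem gaugedRow_of_fin (hm : 0 < m) (W : Matrix (Fin m × Fin d) N ℝ) (i : Fin m) :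
    gaugedRow H hm W i.val = (cycleQ H i)ᵀ * blockRow W i := by
  rw [gaugedRow, dif_pos i.isLt]

theorem gaugedRow_self (hm : 0 < m) (W : Matrix (Fin m × Fin d) N ℝ) :
    gaugedRow H hm W m = blockRow W ⟨0, hm⟩ := by
  rw [gaugedRow, dif_neg (lt_irrefl m)]

theorem blockRow_eq_mul_gaugedRow (hH : ∀ i, H i * (H i)ᵀ = 1) (hm : 0 < m)
    (W : Matrix (Fin m × Fin d) N ℝ) (i : Fin m) :
    blockRow W i = cycleQ H i * gaugedRow H hm W i.val := by
  rw [gaugedRow_of_fin, ← Matrix.mul_assoc, cycleQ_mul_transpose hH, Matrix.one_mul]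

/-- The gauge moves all the measurements into this one closing condition, because `Q` at the first
index is the whole product. -/
theorem gaugedRow_self_eq (hH : ∀ i, H i * (H i)ᵀ = 1) (hm : 0 < m)
    (W : Matrix (Fin m × Fin d) N ℝ) :
    gaugedRow H hm W m = cycleProduct H * gaugedRow H hm W 0 := by
  rw [gaugedRow_self, cycleProduct_eq_cycleQ H hm, blockRow_eq_mul_gaugedRow hH hm W ⟨0, hm⟩]

variable [Fintype N]

theorem gaugedRow_mul_transpose (hH : ∀ i, H i * (H i)ᵀ = 1) (hm : 0 < m)
    {W : Matrix (Fin m × Fin d) N ℝ} (hW : ∀ i, blockRow W i * (blockRow W i)ᵀ = 1) {k : ℕ}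
    (hk : k ≤ m) : gaugedRow H hm W k * (gaugedRow H hm W k)ᵀ = 1 := by
  rcases hk.lt_or_eq with h | rfl
  · rw [gaugedRow, dif_pos h, transpose_mul, transpose_transpose, Matrix.mul_assoc,
      ← Matrix.mul_assoc (blockRow W _), hW, Matrix.one_mul]
    exact mul_eq_one_comm.mp (cycleQ_mul_transpose hH _)
  · rw [gaugedRow_self, hW]

/-- On an inner edge `Q_{i+1} Q_iᵀ = H_iᵀ`. On the closing edge `Q_i = H_i`, and the ungauged first
row takes the place of the next one. -/
theorem trace_edge_eq (hH : ∀ i, H i * (H i)ᵀ = 1) (hm : 0 < m)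
    (W : Matrix (Fin m × Fin d) N ℝ) (i : Fin m) :
    ((H i)ᵀ * block (W * Wᵀ) i (finRotate m i)).trace =
      (gaugedRow H hm W i.val * (gaugedRow H hm W (i.val + 1))ᵀ).trace := by
  obtain ⟨n, rfl⟩ : ∃ n, m = n + 1 := ⟨m - 1, by omega⟩
  rw [block_mul_transpose, gaugedRow_of_fin]
  by_cases h : i.val + 1 < n + 1
  · have hrot : finRotate (n + 1) i = ⟨i.val + 1, h⟩ := finRotate_of_lt (by omega)
    have hQ : cycleQ H ⟨i.val + 1, h⟩ * (cycleQ H i)ᵀ = (H i)ᵀ := by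
      rw [cycleQ_of_lt H i h, transpose_mul, ← mul_assoc, cycleQ_mul_transpose hH, one_mul]
    rw [gaugedRow, dif_pos h, hrot, transpose_mul, transpose_transpose, ← hQ, Matrix.mul_assoc,
      trace_mul_comm]
    simp only [Matrix.mul_assoc]
  · have hi : i = Fin.last n := Fin.ext (by simp only [Fin.val_last]; omega)
    have he : i.val + 1 = n + 1 := by omega
    rw [he, gaugedRow_self, cycleQ_of_not_lt H i h, Matrix.mul_assoc, hi, finRotate_last]
    rfl

theorem cost_eq (hH : ∀ i, H i * (H i)ᵀ = 1) (hm : 0 < m) (W : Matrix (Fin m × Fin d) N ℝ) :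
    ((cycleCost H)ᵀ * (W * Wᵀ)).trace = -2 * ∑ i ∈ Finset.range m,
      (gaugedRow H hm W i * (gaugedRow H hm W (i + 1))ᵀ).trace := by
  rw [trace_cycleCost_mul H (by rw [transpose_mul, transpose_transpose]), Finset.sum_range]
  simp only [trace_edge_eq hH hm]

theorem cost_of_gaugedRow_eq (hH : ∀ i, H i * (H i)ᵀ = 1) (hm : 0 < m)
    {R : Matrix (Fin d) (Fin d) ℝ} {W : Matrix (Fin m × Fin d) N ℝ}
    (hW : ∀ i, blockRow W i * (blockRow W i)ᵀ = 1)
    (hZ : ∀ k ≤ m, gaugedRow H hm W k = R ^ k * gaugedRow H hm W 0) :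
    ((cycleCost H)ᵀ * (W * Wᵀ)).trace = -2 * (m * R.trace) := by
  have h : ∀ i ∈ Finset.range m,
      (gaugedRow H hm W i * (gaugedRow H hm W (i + 1))ᵀ).trace = R.trace := by
    intro i hi
    have him := Finset.mem_range.mp hi
    rw [hZ (i + 1) (by omega), pow_succ', Matrix.mul_assoc, ← hZ i him.le, transpose_mul,
      ← Matrix.mul_assoc, gaugedRow_mul_transpose hH hm hW him.le, Matrix.one_mul, trace_transpose]
  rw [cost_eq hH hm, Finset.sum_congr rfl h]
  simp

/-- The initial row enters only through `Z_0 Z_0ᵀ = 1`, so the blocks do not depend on `W`. This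
gives the explicit formula and also the uniqueness of the solution. -/
theorem block_of_gaugedRow_eq (hH : ∀ i, H i * (H i)ᵀ = 1) (hm : 0 < m)
    {R : Matrix (Fin d) (Fin d) ℝ} (hR : R * Rᵀ = 1) {W : Matrix (Fin m × Fin d) N ℝ}
    (hW : ∀ i, blockRow W i * (blockRow W i)ᵀ = 1)
    (hZ : ∀ k < m, gaugedRow H hm W k = R ^ k * gaugedRow H hm W 0) (i j : Fin m) :
    block (W * Wᵀ) i j = cycleQ H i * R ^ ((i.val : ℤ) - (j.val : ℤ)) * (cycleQ H j)ᵀ := by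
  have hinv : R⁻¹ = Rᵀ := inv_eq_right_inv hR
  have hpow : R ^ ((i.val : ℤ) - (j.val : ℤ)) = R ^ i.val * (R ^ j.val)ᵀ := by
    rw [sub_eq_add_neg, zpow_add ((isUnit_iff_isUnit_det R).mp ⟨⟨R, Rᵀ, hR,
      mul_eq_one_comm.mp hR⟩, rfl⟩), zpow_natCast, zpow_neg_natCast, ← inv_pow', hinv,
      transpose_pow]
  rw [block_mul_transpose, blockRow_eq_mul_gaugedRow hH hm, blockRow_eq_mul_gaugedRow hH hm W j,
    hZ _ i.isLt, hZ _ j.isLt, hpow]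
  calc _ = cycleQ H i * R ^ i.val * (gaugedRow H hm W 0 * (gaugedRow H hm W 0)ᵀ) *
        (R ^ j.val)ᵀ * (cycleQ H j)ᵀ := by
        simp only [transpose_mul, Matrix.mul_assoc]
    _ = _ := by
        rw [gaugedRow_mul_transpose hH hm hW (Nat.zero_le m), Matrix.mul_one]
        simp only [Matrix.mul_assoc]

/-- Lower bound for the cost, with rigidity in the equality case. -/
theorem le_cost_and_rigidity (hm : 2 ≤ m) (hH : ∀ i, H i * (H i)ᵀ = 1)
    {R : Matrix (Fin d) (Fin d) ℝ} (hR : R * Rᵀ = 1) (hRm : R ^ m = cycleProduct H)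
    (hpd : (R + Rᵀ - (2 * Real.cos (Real.pi / m)) • (1 : Matrix (Fin d) (Fin d) ℝ)).PosDef)
    {W : Matrix (Fin m × Fin d) N ℝ} (hW : ∀ i, blockRow W i * (blockRow W i)ᵀ = 1) :
    -2 * (m * R.trace) ≤ ((cycleCost H)ᵀ * (W * Wᵀ)).trace ∧
      (((cycleCost H)ᵀ * (W * Wᵀ)).trace ≤ -2 * (m * R.trace) → ∀ k < m,
        gaugedRow H (by omega) W k = R ^ k * gaugedRow H (by omega) W 0) := by
  have hm0 : 0 < m := by omega
  have h := sum_trace_add_deficit_le hm hR (gaugedRow H hm0 W)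
    (fun _ hk => gaugedRow_mul_transpose hH hm0 hW hk) (by rw [hRm, gaugedRow_self_eq hH])
  have hc := cost_eq hH hm0 W
  have hnn := fun i (_ : i ∈ Finset.range m) => hpd.trace_mul_mul_transpose_nonneg
    (gaugedRow H hm0 W i - R ^ i * gaugedRow H hm0 W 0)
  have hs := Finset.sum_nonneg hnn
  refine ⟨by linarith, fun hle k hk => ?_⟩
  -- Attaining the bound leaves no room for the deficit, a sum of nonnegative terms, so each term
  -- vanishes.
  have hz := (Finset.sum_eq_zero_iff_of_nonneg hnn).mp (by linarith) k (Finset.mem_range.mpr hk)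
  exact sub_eq_zero.mp (hpd.eq_zero_of_trace_mul_mul_transpose_eq_zero hz)

end

/-! ### The explicit minimizer and the conclusion -/

theorem gaugedRow_cycleStack {m d : ℕ} {H : Fin m → Matrix (Fin d) (Fin d) ℝ}
    (hH : ∀ i, H i * (H i)ᵀ = 1) (hm : 0 < m) {R : Matrix (Fin d) (Fin d) ℝ}
    (hR : R * Rᵀ = 1) (hRm : R ^ m = cycleProduct H) {k : ℕ} (hk : k ≤ m) :
    gaugedRow H hm (cycleStack H R) k = R ^ k * gaugedRow H hm (cycleStack H R) 0 := by
  have hinv : R⁻¹ = Rᵀ := inv_eq_right_inv hR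
  have hrow : ∀ (i : ℕ) (hi : i < m), gaugedRow H hm (cycleStack H R) i =
      Rᵀ ^ (m - 1 - i) * (cycleQ H ⟨m - 1, by omega⟩)ᵀ := by
    intro i hi
    have e : blockRow (cycleStack H R) ⟨i, hi⟩ = cycleY H R ⟨i, hi⟩ := rfl
    rw [gaugedRow, dif_pos hi, e, cycleY_eq hH, hinv, ← mul_assoc, ← mul_assoc,
      mul_eq_one_comm.mp (cycleQ_mul_transpose hH _), one_mul]
  rcases hk.lt_or_eq with h | rfl
  · have hc : Commute R Rᵀ := by rw [commute_iff_eq, hR, mul_eq_one_comm.mp hR]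
    have hone : R ^ k * Rᵀ ^ k = 1 := by rw [← hc.mul_pow, hR, one_pow]
    have hs : m - 1 - 0 = k + (m - 1 - k) := by omega
    rw [hrow k h, hrow 0 hm, hs, pow_add, ← mul_assoc, ← mul_assoc, hone, one_mul]
  -- Only the closing row uses that `R` is an `m`-th root of the cycle product.
  · rw [gaugedRow_self_eq hH, hRm]

theorem blockRow_cycleStack_mul_transpose {m d : ℕ} {H : Fin m → Matrix (Fin d) (Fin d) ℝ}
    (hH : ∀ i, H i * (H i)ᵀ = 1) {R : Matrix (Fin d) (Fin d) ℝ} (hR : R * Rᵀ = 1) (i : Fin m) :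
    blockRow (cycleStack H R) i * (blockRow (cycleStack H R) i)ᵀ = 1 := by
  have e : blockRow (cycleStack H R) i = cycleY H R i := rfl
  have hinv : R⁻¹ = Rᵀ := inv_eq_right_inv hR
  have hQ := mul_eq_one_comm.mp (cycleQ_mul_transpose hH ⟨m - 1, by have := i.isLt; omega⟩)
  have hc : Commute Rᵀ R := by rw [commute_iff_eq, hR, mul_eq_one_comm.mp hR]
  have hone : Rᵀ ^ (m - 1 - i.val) * R ^ (m - 1 - i.val) = 1 := by
    rw [← hc.mul_pow, mul_eq_one_comm.mp hR, one_pow]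
  rw [e, cycleY_eq hH, hinv]
  simp only [transpose_mul, transpose_pow, transpose_transpose]
  rw [mul_assoc, ← mul_assoc _ (cycleQ H ⟨m - 1, _⟩), hQ, one_mul, mul_assoc, ← mul_assoc _ (R ^ _),
    hone, one_mul, cycleQ_mul_transpose hH]

/-- The stack has `d` columns, and a single block row, being a co-isometry, already has rank `d`. -/
theorem rank_cycleStack_mul_transpose {m d : ℕ} {H : Fin m → Matrix (Fin d) (Fin d) ℝ}
    (hH : ∀ i, H i * (H i)ᵀ = 1) (hm : 0 < m) {R : Matrix (Fin d) (Fin d) ℝ} (hR : R * Rᵀ = 1) :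
    (cycleStack H R * (cycleStack H R)ᵀ).rank = d := by
  rw [rank_self_mul_transpose]
  refine le_antisymm ((rank_le_card_width _).trans_eq (Fintype.card_fin d)) ?_
  have h : (blockRow (cycleStack H R) ⟨0, hm⟩).rank = d := by
    rw [← rank_self_mul_transpose, blockRow_cycleStack_mul_transpose hH hR, rank_one,
      Fintype.card_fin]
  calc d = (blockRow (cycleStack H R) ⟨0, hm⟩).rank := h.symm
    _ ≤ (cycleStack H R).rank := rank_submatrix_le _ _ _

-- The factor is square of full size, so that feasible points of every rank are covered by the lower
-- bound, which allows any number of columns.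
open scoped MatrixOrder in
theorem _root_.Matrix.PosSemidef.exists_eq_mul_transpose {n : Type*} [Fintype n] [DecidableEq n]
    {X : Matrix n n ℝ} (hX : X.PosSemidef) : ∃ W : Matrix n n ℝ, X = W * Wᵀ := by
  obtain ⟨B, hB⟩ := CStarAlgebra.nonneg_iff_eq_star_mul_self.mp hX.nonneg
  refine ⟨Bᵀ, ?_⟩
  rw [hB, transpose_transpose, star_eq_conjTranspose, conjTranspose_eq_transpose_of_trivial]

end CycleSync

open CycleSync in
theorem mainTheorem9 (d m : ℕ) (hm : 3 ≤ m)
    (H : Fin m → Matrix (Fin d) (Fin d) ℝ)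
    (hH : ∀ i, H i ∈ Matrix.orthogonalGroup (Fin d) ℝ)
    (hP : ¬ Module.End.HasEigenvalue (Matrix.toLin' (CycleSync.cycleProduct H)) (-1)) :
    ∃ R : Matrix (Fin d) (Fin d) ℝ,
      (∀ R', CycleSync.IsPrincipalRoot m (CycleSync.cycleProduct H) R' ↔ R' = R) ∧
      ∃ X : CycleSync.BlockMatrix m d,
        (∀ Z, CycleSync.IsSolution (CycleSync.cycleCost H) Z ↔ Z = X) ∧
        X.rank = d ∧
        X = CycleSync.cycleStack H R * (CycleSync.cycleStack H R).transpose ∧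
        ∀ i j : Fin m, CycleSync.block X i j =
          CycleSync.cycleQ H i * R ^ ((i.val : ℤ) - (j.val : ℤ)) *
            (CycleSync.cycleQ H j).transpose := by
  have hm0 : 0 < m := by omega
  have hH' : ∀ i, H i * (H i)ᵀ = 1 := fun i => by
    simpa [star_eq_conjTranspose] using (Matrix.mem_orthogonalGroup_iff (Fin d) ℝ).mp (hH i)
  have hPo : (cycleProduct H)ᵀ * cycleProduct H = 1 := by
    rw [cycleProduct_eq_cycleQ H hm0]
    exact mul_eq_one_comm.mp (cycleQ_mul_transpose hH' _)
  obtain ⟨R, hroot, hR, hRm, hpd⟩ := exists_unique_principalRoot hm0.ne' hPo hP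
  set Y := cycleStack H R with hY
  have hrow := fun i => blockRow_cycleStack_mul_transpose hH' hR i
  have hgauge := fun k (hk : k ≤ m) => gaugedRow_cycleStack hH' hm0 hR hRm hk
  have hcost := cost_of_gaugedRow_eq hH' hm0 hrow hgauge
  have hblock := block_of_gaugedRow_eq hH' hm0 hR hrow fun k hk => hgauge k hk.le
  have hfeas : Y * Yᵀ ∈ feasibleSet m d :=
    ⟨by simpa using posSemidef_self_mul_conjTranspose Y, hrow⟩
  refine ⟨R, hroot, Y * Yᵀ, fun Z => ⟨fun hZ => ?_, ?_⟩,
    rank_cycleStack_mul_transpose hH' hm0 hR, rfl, hblock⟩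
  · obtain ⟨W, rfl⟩ := hZ.1.1.exists_eq_mul_transpose
    have hle := hZ.2 hfeas
    simp only [Set.mem_ofPred_eq] at hle
    rw [hcost] at hle
    have hrig := (le_cost_and_rigidity (by omega) hH' hR hRm hpd hZ.1.2).2 hle
    refine ext_block fun i j => ?_
    -- By rigidity the competitor has the same block formula as the candidate.
    rw [hblock, block_of_gaugedRow_eq hH' hm0 hR hZ.1.2 hrig]
  · rintro rfl
    refine ⟨hfeas, fun Z hZ => ?_⟩
    obtain ⟨W, rfl⟩ := hZ.1.exists_eq_mul_transpose
    simp only [Set.mem_ofPred_eq]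
    rw [hcost]
    exact (le_cost_and_rigidity (by omega) hH' hR hRm hpd hZ.2).1
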